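/- Let $p$ be an odd prime, $m\ge 1$, $\mathbb M=\mathbb F_{p^m}$ and $\mathbb F=\mathbb M\times\mathbb M$, regarded as an $\mathbb F_p$-vector space; $\mathrm{GL}(\mathbb F)$ is the group of its $\mathbb F_p$-linear bijections. For integers $k,l\ge 0$ and $q=p^k$, $r=p^l$, a $(q,r)$-biprojective mapping is a map $F(x,y)=[f(x,y),g(x,y)]$ of $\mathbb F$ with $$f=a_0x^{q+1}+b_0x^qy+c_0xy^q+d_0y^{q+1},\qquad g=a_1x^{r+1}+b_1x^ry+c_1xy^r+d_1y^{r+1},$$ all coefficients in $\mathbb M$. It is planar if its polarization $\Delta_F(z,w)=F(z+w)-F(z)-F(w)$ satisfies $\Delta_F(z,w)\ne 0$ for all non-zero $z,w\in\mathbb F$. A $(q,r)$-biprojective pre-semifield is $(\mathbb F,+,\ast)$ with $z\ast w=\Delta_F(z,w)$ for a planar $(q,r)$-biprojective $F$. An isotopism from $(\mathbb F,+,\ast_1)$ to $(\mathbb F,+,\ast_2)$ is a triple $(N,L,M)\in\mathrm{GL}(\mathbb F)^3$ with $N(z\ast_1 w)=L(z)\ast_2 M(w)$ for all $z,w$; the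 two are isotopic if there is one. The isotopisms from $\mathbb P$ to itself form the subgroup $\mathrm{Aut}(\mathbb P)\le\mathrm{GL}(\mathbb F)^3$. For $A\in\mathrm{GL}(\mathbb F)$ write $A(x,y)=(A_1(x)+A_2(y),\,A_3(x)+A_4(y))$; the $A_i:\mathbb M\to\mathbb M$ are the subfunctions of $A$. A monomial of degree $p^t$ is a map $x\mapsto cx^{p^t}$ of $\mathbb M$ with $c\ne0$ (as a map it depends on $t$ only modulo $m$). For $a\in\mathbb M^\times$ put $\gamma_a=(N_a,L_a,L_a)$ with $N_a(x,y)=(a^{q+1}x,a^{r+1}y)$ and $L_a(x,y)=(ax,ay)$. Put $Z^{(q,r)}=\{\gamma_a: a\in\mathbb M^\times\}$. Let $p'$ be a $p$-primitive prime divisor of $p^m-1$ (a prime with $p'\mid p^m-1$ and $p'\nmid p^i-1$ for $1\le i\le m-1$), let $R$ be the Sylow $p'$-subgroup of $\mathbb M^\times$, let $Z_R^{(q,r)}=\{\gamma_a: a\in R\}$, and for a $(q,r)$-biprojective pre-semifield $\mathbb P$ let $C_{\mathbb P}$ be the centralizer of $Z_R^{(q,r)}$ in $\mathrm{Aut}(\mathbb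 P)$. **Theorem.** For $i=1,2$ let $\mathbb P_i$ be a $(q_i,r_i)$-biprojective pre-semifield on $\mathbb F$, where $q_i=p^{k_i}$ and $r_i=p^{l_i}$. Assume that $k_1\not\equiv\pm l_1\pmod m$, that $k_1\not\equiv 0$ and $l_1\not\equiv0\pmod m$, and, if $m$ is even, that $k_1\not\equiv m/2$ and $l_1\not\equiv m/2\pmod m$ (that is, $q_1\notin\{r_1,\overline{r_1}\}$, $1\notin\{q_1,r_1\}$ and $p^{m/2}\notin\{q_1,r_1\}$ as exponents modulo $p^m-1$, where $\overline{r_1}=p^{m-l_1}$). Assume further: (C) $C_{\mathbb P_1}$ contains $Z^{(q_1,r_1)}$ as a subgroup of index $I$ with $p'\nmid I$. If $\mathbb P_1$ and $\mathbb P_2$ are isotopic, then there are an isotopism $(N,L,M)$ from $\mathbb P_1$ to $\mathbb P_2$ and an integer $0\le t<m$ such that * all non-zero subfunctions of $N,L,M$ are monomials; * all non-zero subfunctions of $L$ and $M$ have the same degree $p^t$; * either $k_1\equiv\pm k_2$ and $l_1\equiv\pm l_2\pmod m$, or $k_1\equiv\pm l_2$ and $l_1\equiv\pm k_2\pmod m$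 (with independent signs). More precisely, one of the following holds (all congruences modulo $m$). 1. $N_2=N_3=0$, $N_1,N_4\ne0$, $k_1\equiv\pm k_2$ and $l_1\equiv\pm l_2$. If $k_1\equiv k_2$, then $N_1$ is a monomial of degree $p^t$; if $k_1\equiv-k_2$, of degree $p^{t+k_2}$. If $l_1\equiv l_2$, then $N_4$ is a monomial of degree $p^t$; if $l_1\equiv-l_2$, of degree $p^{t+l_2}$. 2. $N_1=N_4=0$, $N_2,N_3\ne0$, $k_1\equiv\pm l_2$ and $l_1\equiv\pm k_2$. If $k_1\equiv l_2$, then $N_3$ is a monomial of degree $p^t$; if $k_1\equiv-l_2$, of degree $p^{t+l_2}$. If $l_1\equiv k_2$, then $N_2$ is a monomial of degree $p^t$; if $l_1\equiv-k_2$, of degree $p^{t+k_2}$. -/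

import Mathlib

/-- The `(q, r)`-biprojective mapping `F(x, y) = [f(x, y), g(x, y)]` of `K × K`, where `q = p ^ k`,
`r = p ^ l`, `f = (a₀, b₀, c₀, d₀)_q` and `g = (a₁, b₁, c₁, d₁)_r`. -/
def biprojectiveMap {K : Type*} [Field K] (p k l : ℕ) (a₀ b₀ c₀ d₀ a₁ b₁ c₁ d₁ : K) :
    K × K → K × K := fun w =>
  (a₀ * w.1 ^ (p ^ k + 1) + b₀ * w.1 ^ (p ^ k) * w.2 + c₀ * w.1 * w.2 ^ (p ^ k)
      + d₀ * w.2 ^ (p ^ k + 1),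
   a₁ * w.1 ^ (p ^ l + 1) + b₁ * w.1 ^ (p ^ l) * w.2 + c₁ * w.1 * w.2 ^ (p ^ l)
      + d₁ * w.2 ^ (p ^ l + 1))

/-- The polarization `Δ_F(x, y) = F(x + y) - F(x) - F(y)`. -/
def polarization {V : Type*} [AddCommGroup V] (F : V → V) : V → V → V :=
  fun x y => F (x + y) - F x - F y

/-- Planarity: `Δ_F(x, a) = 0` with `a ≠ 0` forces `x = 0`. -/
def IsPlanar {V : Type*} [AddCommGroup V] (F : V → V) : Prop :=
  ∀ a : V, a ≠ 0 → ∀ x : V, polarization F x a = 0 → x = 0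

/-- `mul` is the multiplication of a `(p ^ k, p ^ l)`-biprojective pre-semifield `(K × K, +, mul)`:
it is the polarization of a planar `(p ^ k, p ^ l)`-biprojective mapping. -/
def IsBiprojectivePreSemifield {K : Type*} [Field K] (p k l : ℕ)
    (mul : K × K → K × K → K × K) : Prop :=
  ∃ a₀ b₀ c₀ d₀ a₁ b₁ c₁ d₁ : K,
    IsPlanar (biprojectiveMap p k l a₀ b₀ c₀ d₀ a₁ b₁ c₁ d₁) ∧
      mul = polarization (biprojectiveMap p k l a₀ b₀ c₀ d₀ a₁ b₁ c₁ d₁)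

/-- The group `GL(V)³` of triples of `𝔽_p`-linear bijections, with component-wise composition. -/
abbrev GLTriple (p : ℕ) (V : Type*) [AddCommGroup V] [Module (ZMod p) V] : Type _ :=
  (V ≃ₗ[ZMod p] V) × (V ≃ₗ[ZMod p] V) × (V ≃ₗ[ZMod p] V)

/-- `(N, L, M)` is an isotopism from `(V, +, mul₁)` to `(V, +, mul₂)`. -/
def IsIsotopism {p : ℕ} {V : Type*} [AddCommGroup V] [Module (ZMod p) V]
    (mul₁ mul₂ : V → V → V) (g : GLTriple p V) : Prop :=
  ∀ x y : V, g.1 (mul₁ x y) = mul₂ (g.2.1 x) (g.2.2 y)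

/-- Isotopy of `(V, +, mul₁)` and `(V, +, mul₂)`. -/
def IsIsotopic (p : ℕ) {V : Type*} [AddCommGroup V] [Module (ZMod p) V]
    (mul₁ mul₂ : V → V → V) : Prop :=
  ∃ g : GLTriple p V, IsIsotopism mul₁ mul₂ g

/-- The autotopism group, as a subgroup of `GL(V)³`. -/
def autotopismGroup (p : ℕ) {V : Type*} [AddCommGroup V] [Module (ZMod p) V]
    (mul : V → V → V) : Subgroup (GLTriple p V) where
  carrier := {g | IsIsotopism mul mul g}
  mul_mem' := by
    intro a b ha hb x y
    have h1 := hb x y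
    have h2 := ha (b.2.1 x) (b.2.2 y)
    simp only [Prod.fst_mul, Prod.snd_mul, LinearEquiv.mul_apply]
    rw [h1, h2]
  one_mem' := by
    intro x y
    rfl
  inv_mem' := by
    intro a ha x y
    have h := ha (a.2.1.symm x) (a.2.2.symm y)
    simp only [LinearEquiv.apply_symm_apply] at h
    change a.1.symm (mul x y) = mul (a.2.1.symm x) (a.2.2.symm y)
    rw [← h, LinearEquiv.symm_apply_apply]

/-- The map `diag(m_a, m_b) : (x, y) ↦ (a x, b y)` of `K × K`, for `a, b ∈ Kˣ`. -/
def diagMul (p : ℕ) {K : Type*} [Field K] [Algebra (ZMod p) K] (a b : Kˣ) :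
    (K × K) ≃ₗ[ZMod p] (K × K) :=
  LinearEquiv.prodCongr (DistribMulAction.toModuleAut (ZMod p) K a)
    (DistribMulAction.toModuleAut (ZMod p) K b)

theorem diagMul_apply (p : ℕ) {K : Type*} [Field K] [Algebra (ZMod p) K] (a b : Kˣ) (w : K × K) :
    diagMul p a b w = ((a : K) * w.1, (b : K) * w.2) := rfl

/-- The homomorphism `a ↦ γ_a`, where
`γ_a = (diag(m_{a^{q+1}}, m_{a^{r+1}}), diag(m_a, m_a), diag(m_a, m_a))`, `q = p ^ k`,
`r = p ^ l`. -/
def gammaHom (p k l : ℕ) (K : Type*) [Field K] [Algebra (ZMod p) K] :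
    Kˣ →* GLTriple p (K × K) where
  toFun a := (diagMul p (a ^ (p ^ k + 1)) (a ^ (p ^ l + 1)), diagMul p a a, diagMul p a a)
  map_one' := by
    refine Prod.ext ?_ (Prod.ext ?_ ?_) <;>
    · refine LinearEquiv.ext fun w => ?_
      simp [diagMul_apply]
  map_mul' a b := by
    refine Prod.ext ?_ (Prod.ext ?_ ?_) <;>
    · refine LinearEquiv.ext fun w => ?_
      simp [diagMul_apply, mul_pow, mul_assoc]

/-- The cyclic group `Z^{(q, r)} = {γ_a : a ∈ Kˣ}`, with `q = p ^ k` and `r = p ^ l`. -/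
def groupZ (p k l : ℕ) (K : Type*) [Field K] [Algebra (ZMod p) K] :
    Subgroup (GLTriple p (K × K)) :=
  (gammaHom p k l K).range

/-- The group `Z_R^{(q, r)} = {γ_a : a ∈ R}`, with `q = p ^ k` and `r = p ^ l`. -/
def groupZR (p k l : ℕ) {K : Type*} [Field K] [Algebra (ZMod p) K] (R : Subgroup Kˣ) :
    Subgroup (GLTriple p (K × K)) :=
  R.map (gammaHom p k l K)

/-- The centralizer `C_P` of `Z_R^{(q, r)}` in the autotopism group of `(K × K, +, mul)`. -/
def centralizerZR (p k l : ℕ) {K : Type*} [Field K] [Algebra (ZMod p) K] (R : Subgroup Kˣ)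
    (mul : K × K → K × K → K × K) : Subgroup (GLTriple p (K × K)) :=
  autotopismGroup p mul ⊓ Subgroup.centralizer (groupZR p k l R : Set (GLTriple p (K × K)))

/-- `p'` is a `p`-primitive (prime) divisor of `p ^ m - 1`. -/
def IsPrimitivePrimeDivisor (p m p' : ℕ) : Prop :=
  p'.Prime ∧ p' ∣ p ^ m - 1 ∧ ∀ i : ℕ, 1 ≤ i → i ≤ m - 1 → ¬ p' ∣ p ^ i - 1

/-- The subfunctions of `A = (A₁ A₂; A₃ A₄)`, that is,
`A (x, y) = (A₁ x + A₂ y, A₃ x + A₄ y)`. -/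
def sub₁ {p : ℕ} {K : Type*} [Field K] [Algebra (ZMod p) K] (A : (K × K) ≃ₗ[ZMod p] (K × K)) :
    K → K := fun x => (A (x, 0)).1

/-- See `sub₁`. -/
def sub₂ {p : ℕ} {K : Type*} [Field K] [Algebra (ZMod p) K] (A : (K × K) ≃ₗ[ZMod p] (K × K)) :
    K → K := fun y => (A (0, y)).1

/-- See `sub₁`. -/
def sub₃ {p : ℕ} {K : Type*} [Field K] [Algebra (ZMod p) K] (A : (K × K) ≃ₗ[ZMod p] (K × K)) :
    K → K := fun x => (A (x, 0)).2

/-- See `sub₁`. -/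
def sub₄ {p : ℕ} {K : Type*} [Field K] [Algebra (ZMod p) K] (A : (K × K) ≃ₗ[ZMod p] (K × K)) :
    K → K := fun y => (A (0, y)).2

/-- `A` is (the mapping of) a non-zero monomial `c x ^ (p ^ t)` of degree `p ^ t`; as mappings of
`𝔽_{p ^ m}`, degrees `p ^ t` matter only through `t` modulo `m`. -/
def IsMonomial {K : Type*} [Field K] (p t : ℕ) (A : K → K) : Prop :=
  ∃ c : K, c ≠ 0 ∧ ∀ x : K, A x = c * x ^ (p ^ t)

/-- All non-zero subfunctions of `A` are monomials. -/
def SubfunctionsMonomial {p : ℕ} {K : Type*} [Field K] [Algebra (ZMod p) K]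
    (A : (K × K) ≃ₗ[ZMod p] (K × K)) : Prop :=
  (sub₁ A ≠ 0 → ∃ t, IsMonomial p t (sub₁ A)) ∧ (sub₂ A ≠ 0 → ∃ t, IsMonomial p t (sub₂ A)) ∧
  (sub₃ A ≠ 0 → ∃ t, IsMonomial p t (sub₃ A)) ∧ (sub₄ A ≠ 0 → ∃ t, IsMonomial p t (sub₄ A))

/-- All non-zero subfunctions of `A` are monomials of the one degree `p ^ t`. -/
def SubfunctionsMonomialOfDegree {p : ℕ} {K : Type*} [Field K] [Algebra (ZMod p) K] (t : ℕ)
    (A : (K × K) ≃ₗ[ZMod p] (K × K)) : Prop :=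
  (sub₁ A ≠ 0 → IsMonomial p t (sub₁ A)) ∧ (sub₂ A ≠ 0 → IsMonomial p t (sub₂ A)) ∧
  (sub₃ A ≠ 0 → IsMonomial p t (sub₃ A)) ∧ (sub₄ A ≠ 0 → IsMonomial p t (sub₄ A))

/-- `a ≡ ± b (mod m)`. -/
def CongrPM (m a b : ℕ) : Prop :=
  (a : ℤ) ≡ (b : ℤ) [ZMOD (m : ℤ)] ∨ (a : ℤ) ≡ -(b : ℤ) [ZMOD (m : ℤ)]

set_option linter.unusedSectionVars false

/-! The argument has a group-theoretic and a coefficient-comparing half. Condition (C) makes `Z_R` a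
Sylow `p'`-subgroup of the autotopism group of the first pre-semifield: a `p'`-element normalizing
`Z_R` acts on it through a power of Frobenius, hence trivially because `p'` is prime to `m`, so it
lies in the centralizer, whose `p'`-part is only `|R|` (`not_dvd_card_autotopismGroup`). Pulling
back the other `Z_R` along any isotopism gives a second subgroup of the same order, and Sylow
conjugacy corrects the isotopism to one carrying `Z_R` into `Z_R` (`exists_isotopism_semiconj`).
Such an isotopism intertwines multiplications by elements of order `p'`. These generate the field,
so every non-zero subfunction is a scalar times a field automorphism
(`exists_isMonomial_of_intertwines`). Substituting scalar multiples `x z`, `u w` into the isotopism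
identity then gives a relation between functions `x ^ (p ^ i) * u ^ (p ^ j)`. Independence of
characters forces the exponents to match (`degree_of_component`), which yields the congruences and
degrees, and forbids two non-zero entries in a row of `N`. -/

/-- If `p'` divides `p ^ m - 1` primitively, then `p` has multiplicative order `m` modulo `p'`. -/
theorem IsPrimitivePrimeDivisor.orderOf_eq {p m p' : ℕ} (hp : p ≠ 0) (hm : 0 < m)
    (h : IsPrimitivePrimeDivisor p m p') : orderOf (p : ZMod p') = m := by
  obtain ⟨_, hd, hmin⟩ := h
  have key (i : ℕ) : (p : ZMod p') ^ i = 1 ↔ p' ∣ p ^ i - 1 := by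
    have h1 : 1 ≤ p ^ i := Nat.one_le_pow _ _ (Nat.pos_of_ne_zero hp)
    rw [← ZMod.natCast_eq_zero_iff, Nat.cast_sub h1, sub_eq_zero]
    simp
  rw [orderOf_eq_iff hm]
  refine ⟨(key m).2 hd, fun i hi hi0 hpi => hmin i hi0 (by omega) ((key i).1 hpi)⟩

/-! ### Arithmetic of primitive prime divisors. -/

theorem IsPrimitivePrimeDivisor.dvd_of_pow_eq_one {p m p' : ℕ} (hp : p ≠ 0) (hm : 0 < m)
    (h : IsPrimitivePrimeDivisor p m p') {i : ℕ} (hi : (p : ZMod p') ^ i = 1) : m ∣ i :=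
  h.orderOf_eq hp hm ▸ orderOf_dvd_of_pow_eq_one hi

/-- The order `m` of `p` modulo `p'` divides `p' - 1`, so `p' ∣ m` would give `p' ∣ p' - 1`. -/
theorem IsPrimitivePrimeDivisor.coprime {p m p' : ℕ} (hp : p ≠ 0) (hm : 0 < m)
    (h : IsPrimitivePrimeDivisor p m p') : p'.Coprime m := by
  have : Fact p'.Prime := ⟨h.1⟩
  have h0 : (p : ZMod p') ≠ 0 := by
    intro h0
    have h1 := pow_orderOf_eq_one (p : ZMod p')
    rw [h.orderOf_eq hp hm, h0, zero_pow hm.ne'] at h1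
    exact zero_ne_one h1
  have h1 : m ∣ p' - 1 := h.orderOf_eq hp hm ▸ ZMod.orderOf_dvd_card_sub_one h0
  refine (Nat.Prime.coprime_iff_not_dvd h.1).2 fun h2 => ?_
  have h3 := Nat.le_of_dvd (Nat.sub_pos_of_lt h.1.one_lt) (h2.trans h1)
  have := h.1.one_lt
  omega

/-- If `p ^ k = -1` modulo `p'`, squaring gives `m ∣ 2 * k`. The coprimality keeps `ω ^ (q + 1)` of
order `p'` when `ω` is. -/
theorem IsPrimitivePrimeDivisor.coprime_pow_add_one {p m p' k : ℕ} (hp : p ≠ 0) (hm : 0 < m)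
    (h : IsPrimitivePrimeDivisor p m p') (hk : ¬ m ∣ 2 * k) : (p ^ k + 1).Coprime p' := by
  refine ((Nat.Prime.coprime_iff_not_dvd h.1).2 fun hd => hk ?_).symm
  refine h.dvd_of_pow_eq_one hp hm ?_
  have h1 : (p : ZMod p') ^ k = -1 := by
    have := (ZMod.natCast_eq_zero_iff _ _).2 hd
    push_cast at this
    exact eq_neg_of_add_eq_zero_left this
  rw [mul_comm, pow_mul, h1]
  norm_num

/-! ### Frobenius powers, monomials and independence of characters. -/

section Field

variable {p m : ℕ} [Fact p.Prime] {K : Type*} [Field K] [Finite K] [Algebra (ZMod p) K]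

theorem finrank_eq_of_card (hK : Nat.card K = p ^ m) : Module.finrank (ZMod p) K = m := by
  have h := Module.natCard_eq_pow_finrank (K := ZMod p) (V := K)
  rw [hK, Nat.card_zmod] at h
  exact (Nat.pow_right_injective (Fact.out : p.Prime).two_le h).symm

theorem pow_pow_eq_self (hK : Nat.card K = p ^ m) (x : K) : x ^ p ^ m = x := by
  have := Fintype.ofFinite K
  rw [← hK, Nat.card_eq_fintype_card, FiniteField.pow_card]

theorem pow_pow_eq_of_modEq (hK : Nat.card K = p ^ m) {i j : ℕ} (h : i ≡ j [MOD m]) (x : K) :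
    x ^ p ^ i = x ^ p ^ j := by
  have key (a n : ℕ) : x ^ p ^ (a + m * n) = x ^ p ^ a := by
    induction n with
    | zero => simp
    | succ n ih =>
      rw [Nat.mul_succ, ← add_assoc, pow_add, pow_mul, ih, ← pow_mul, mul_comm, pow_mul,
        pow_pow_eq_self hK]
  rw [← Nat.mod_add_div i m, ← Nat.mod_add_div j m, key, key, h]

variable (p) in
theorem add_pow_pow (n : ℕ) (x y : K) : (x + y) ^ p ^ n = x ^ p ^ n + y ^ p ^ n := by
  have : CharP K p := charP_of_injective_algebraMap (algebraMap (ZMod p) K).injective p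
  exact add_pow_char_pow x y p n

theorem modEq_of_pow_pow_eq {p' : ℕ} (hm : 0 < m) (hp' : IsPrimitivePrimeDivisor p m p')
    {a : Kˣ} (ha : orderOf a = p') {i j : ℕ} (h : (a : K) ^ p ^ i = (a : K) ^ p ^ j) :
    i ≡ j [MOD m] := by
  have : Fact p'.Prime := ⟨hp'.1⟩
  have hp := (Fact.out : p.Prime).ne_zero
  have h1 : a ^ p ^ i = a ^ p ^ j := Units.ext (by simpa using h)
  rw [pow_eq_pow_iff_modEq, ha, ← ZMod.natCast_eq_natCast_iff] at h1
  push_cast at h1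
  have h0 : orderOf (p : ZMod p') = m := hp'.orderOf_eq hp hm
  rw [← h0]
  refine (IsOfFinOrder.pow_eq_pow_iff_modEq ?_).1 h1
  exact orderOf_pos_iff.1 (by omega)

/-- A subfield of order `p ^ d` containing `a` gives `a ^ p ^ d = a`, hence `m ∣ d`. -/
theorem adjoin_eq_top_of_orderOf {p' : ℕ} (hm : 0 < m) (hK : Nat.card K = p ^ m)
    (hp' : IsPrimitivePrimeDivisor p m p') {a : Kˣ} (ha : orderOf a = p') :
    Algebra.adjoin (ZMod p) {(a : K)} = ⊤ := by
  have h1 : IntermediateField.adjoin (ZMod p) {(a : K)} = ⊤ := by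
    set E := IntermediateField.adjoin (ZMod p) {(a : K)} with hE
    have hEK : Nat.card E = p ^ Module.finrank (ZMod p) E := by
      rw [Module.natCard_eq_pow_finrank (K := ZMod p), Nat.card_zmod]
    have haE : (a : K) ∈ E := IntermediateField.mem_adjoin_simple_self _ _
    have h2 := pow_pow_eq_self hEK (⟨a, haE⟩ : E)
    have h3 : (a : K) ^ p ^ Module.finrank (ZMod p) E = (a : K) ^ p ^ 0 := by
      simpa using congrArg Subtype.val h2
    have h4 := (Nat.modEq_zero_iff_dvd).1 (modEq_of_pow_pow_eq hm hp' ha h3)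
    have h5 := Nat.le_of_dvd Module.finrank_pos h4
    refine IntermediateField.eq_of_le_of_finrank_le le_top ?_
    rw [IntermediateField.finrank_top', finrank_eq_of_card hK]
    exact h5
  rw [← IntermediateField.adjoin_simple_toSubalgebra_of_isAlgebraic
    (Algebra.IsAlgebraic.isAlgebraic (a : K)), h1, IntermediateField.top_toSubalgebra]

/-- A non-zero linear map that intertwines multiplication by a generator `a` of the field with
multiplication by some `b` is a monomial. -/
theorem exists_isMonomial_of_intertwines (hK : Nat.card K = p ^ m) {a b : K}
    (ha : Algebra.adjoin (ZMod p) {a} = ⊤) {A : K →ₗ[ZMod p] K}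
    (hA : ∀ x, A (a * x) = b * A x) (hA0 : A ≠ 0) : ∃ t < m, IsMonomial p t A := by
  -- The multipliers `y` that `A` turns into some multiplier form a subalgebra containing `a`, hence
  -- everything.
  have hs (y : K) : ∃ s, ∀ x, A (y * x) = s * A x := by
    have hy : y ∈ Algebra.adjoin (ZMod p) {a} := ha ▸ Algebra.mem_top
    induction hy using Algebra.adjoin_induction with
    | mem y hy => exact ⟨b, fun x => by rw [Set.mem_singleton_iff.1 hy, hA]⟩
    | algebraMap r =>
      exact ⟨algebraMap _ _ r, fun x => by rw [← Algebra.smul_def, map_smul, Algebra.smul_def]⟩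
    | add y z _ _ hy hz =>
      obtain ⟨s, hs⟩ := hy
      obtain ⟨u, hu⟩ := hz
      exact ⟨s + u, fun x => by rw [add_mul, map_add, hs, hu, add_mul]⟩
    | mul y z _ _ hy hz =>
      obtain ⟨s, hs⟩ := hy
      obtain ⟨u, hu⟩ := hz
      exact ⟨s * u, fun x => by rw [mul_assoc, hs, hu, mul_assoc]⟩
  have hc : A 1 ≠ 0 := by
    intro hc
    refine hA0 (LinearMap.ext fun y => ?_)
    obtain ⟨s, hs⟩ := hs y
    simpa [hc] using hs 1
  have hmul (y x : K) : A (y * x) * A 1 = A y * A x := by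
    obtain ⟨s, hs⟩ := hs y
    have h1 := hs 1
    rw [mul_one] at h1
    rw [hs x, h1]
    ring
  -- Normalized to fix `1`, the map is multiplicative, so it is a power of Frobenius.
  let φ : K →ₐ[ZMod p] K := AlgHom.ofLinearMap ((A 1)⁻¹ • A) (by simp [hc]) (fun x y => by
    simp only [LinearMap.smul_apply, smul_eq_mul]
    field_simp
    rw [← hmul x y, mul_comm])
  have hφ (x : K) : A x = A 1 * φ x := by
    simp [φ, hc]
  obtain ⟨n, hn⟩ := (FiniteField.bijective_frobeniusAlgEquivOfAlgebraic_pow (ZMod p) K).2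
    (AlgEquiv.ofBijective φ (Algebra.IsAlgebraic.algHom_bijective φ))
  refine ⟨n, by simpa only [finrank_eq_of_card hK] using n.2, A 1, hc, fun x => ?_⟩
  rw [hφ]
  congr 1
  have := congrArg (fun f => f x) hn
  simp only [AlgEquiv.coe_pow, FiniteField.coe_frobeniusAlgEquivOfAlgebraic_iterate,
    AlgEquiv.coe_ofBijective, ZMod.card] at this
  exact this.symm

theorem IsMonomial.congr_modEq (hK : Nat.card K = p ^ m) {s t : ℕ} {A : K → K}
    (hA : IsMonomial p s A) (h : s ≡ t [MOD m]) : IsMonomial p t A := by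
  obtain ⟨c, hc, hA⟩ := hA
  exact ⟨c, hc, fun x => by rw [hA, pow_pow_eq_of_modEq hK h]⟩

theorem IsMonomial.ne_zero {t : ℕ} {A : K → K} (hA : IsMonomial p t A) : A ≠ 0 := by
  obtain ⟨c, hc, hA⟩ := hA
  intro h
  have := hA 1
  simp [h] at this
  exact hc this.symm

theorem IsMonomial.apply_mul {t : ℕ} {A : K → K} (hA : IsMonomial p t A) (a x : K) :
    A (a * x) = a ^ p ^ t * A x := by
  obtain ⟨c, hc, hA⟩ := hA
  rw [hA, hA]
  ring

theorem IsMonomial.eq_of_intertwines {t : ℕ} {A : K → K} (hA : IsMonomial p t A) {a b : K}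
    (h : ∀ x, A (a * x) = b * A x) : b = a ^ p ^ t := by
  have h1 := h 1
  rw [hA.apply_mul] at h1
  obtain ⟨c, hc, hA⟩ := hA
  refine (mul_right_cancel₀ ?_ h1).symm
  simpa [hA] using hc

/-- The character `(x, u) ↦ x ^ (p ^ i) * u ^ (p ^ j)` of `K × K`. -/
def frobChar (p : ℕ) (K : Type*) [Field K] (ij : ℕ × ℕ) : K × K →* K where
  toFun w := w.1 ^ p ^ ij.1 * w.2 ^ p ^ ij.2
  map_one' := by simp
  map_mul' x y := by simp only [Prod.fst_mul, Prod.snd_mul, mul_pow]; ring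

theorem frobChar_eq {p' : ℕ} (hm : 0 < m) (hp' : IsPrimitivePrimeDivisor p m p')
    {a : Kˣ} (ha : orderOf a = p') {i j : ℕ × ℕ} (h : frobChar p K i = frobChar p K j) :
    i.1 ≡ j.1 [MOD m] ∧ i.2 ≡ j.2 [MOD m] := by
  have h1 := DFunLike.congr_fun h ((a : K), 1)
  have h2 := DFunLike.congr_fun h (1, (a : K))
  simp only [frobChar, MonoidHom.coe_mk, OneHom.coe_mk, one_pow, mul_one, one_mul] at h1 h2
  exact ⟨modEq_of_pow_pow_eq hm hp' ha h1, modEq_of_pow_pow_eq hm hp' ha h2⟩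

/-- A character that occurs in a linear relation between two-variable Frobenius monomials equals
one of the others. -/
theorem exists_frobChar_eq {ι : Type*} (s : Finset ι) (i₀ : ℕ × ℕ) (i : ι → ℕ × ℕ) {c₀ : K}
    (c : ι → K) (hc₀ : c₀ ≠ 0)
    (h : ∀ x u : K, c₀ * (x ^ p ^ i₀.1 * u ^ p ^ i₀.2) =
      ∑ n ∈ s, c n * (x ^ p ^ (i n).1 * u ^ p ^ (i n).2)) :
    ∃ n ∈ s, frobChar p K i₀ = frobChar p K (i n) := by
  by_contra! hne
  refine (linearIndependent_monoidHom (K × K) K).notMem_span_image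
    (s := {f | ∃ n ∈ s, f = frobChar p K (i n)}) (x := frobChar p K i₀)
    (by rintro ⟨n, hn, h⟩; exact hne n hn h) ?_
  have h1 : (frobChar p K i₀ : K × K → K) =
      ∑ n ∈ s, (c₀⁻¹ * c n) • (frobChar p K (i n) : K × K → K) := by
    funext w
    have := h w.1 w.2
    simp only [Finset.sum_apply, Pi.smul_apply, smul_eq_mul, mul_assoc]
    rw [← Finset.mul_sum, eq_inv_mul_iff_mul_eq₀ hc₀]
    exact this
  rw [h1]
  refine Submodule.sum_mem _ fun n hn => Submodule.smul_mem _ _ (Submodule.subset_span ?_)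
  exact ⟨_, ⟨n, hn, rfl⟩, rfl⟩

end Field

/-! ### Sylow arguments in a finite group. -/

section Group

/-- A `p`-subgroup `H` of `A` is a Sylow subgroup of `A` as soon as every `p`-element of `A` that
normalizes `H` lies in a subgroup `C` whose order is not divisible by `p * |H|`. -/
theorem not_dvd_card_of_normalizing {G : Type*} [Group G] [Finite G] {p n : ℕ} [Fact p.Prime]
    {H A C : Subgroup G} (hHA : H ≤ A) (hH : Nat.card H = p ^ n)
    (hC : ¬ p ^ (n + 1) ∣ Nat.card C)
    (h : ∀ g ∈ A, (∀ x ∈ H, g * x * g⁻¹ ∈ H) → (∃ s, g ^ p ^ s = 1) → g ∈ C) :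
    ¬ p ^ (n + 1) ∣ Nat.card A := by
  intro hA
  have hH' : Nat.card (H.subgroupOf A) = p ^ n := by
    rw [← hH, Nat.card_congr (Subgroup.subgroupOfEquivOfLe hHA).toEquiv]
  -- A `p`-subgroup that is not Sylow is not Sylow in its normalizer either; a subgroup of order `p
  -- ^ (n + 1)` there would lie in `C`.
  have h1 := Sylow.prime_pow_dvd_card_normalizer hA hH'
  obtain ⟨S, hS⟩ := Sylow.exists_subgroup_card_pow_prime p h1
  let T : Subgroup G :=
    (S.map (Subgroup.normalizer (H.subgroupOf A : Set A)).subtype).map A.subtype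
  have hT : Nat.card T = p ^ (n + 1) := by
    rw [Subgroup.card_map_of_injective A.subtype_injective,
      Subgroup.card_map_of_injective (Subgroup.subtype_injective _), hS]
  refine hC (hT ▸ Subgroup.card_dvd_of_le ?_)
  rintro _ ⟨_, ⟨g, hg, rfl⟩, rfl⟩
  refine h _ g.1.2 (fun x hx => ?_) ?_
  · have h2 := (Subgroup.mem_normalizer_iff.1 g.2 ⟨x, hHA hx⟩).1 (Subgroup.mem_subgroupOf.2 hx)
    simpa [Subgroup.mem_subgroupOf] using h2
  · obtain ⟨s, hs⟩ := IsPGroup.of_card hS ⟨g, hg⟩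
    refine ⟨s, ?_⟩
    have h2 := congrArg (fun y : S => (y.1.1.1 : G)) hs
    simpa using h2

/-- Two `p`-subgroups of maximal order are conjugate. -/
theorem exists_conj_of_card_eq {G : Type*} [Group G] [Finite G] {p n : ℕ} [Fact p.Prime]
    {H₁ H₂ A : Subgroup G} (h₁ : H₁ ≤ A) (h₂ : H₂ ≤ A) (hH₁ : Nat.card H₁ = p ^ n)
    (hH₂ : Nat.card H₂ = p ^ n) (hA : ¬ p ^ (n + 1) ∣ Nat.card A) :
    ∃ g ∈ A, ∀ x ∈ H₁, g * x * g⁻¹ ∈ H₂ := by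
  have hn : (Nat.card A).factorization p ≤ n := by
    by_contra! hlt
    exact hA ((pow_dvd_pow p hlt).trans (Nat.ordProj_dvd _ _))
  have hcard {H : Subgroup G} (h : H ≤ A) (hH : Nat.card H = p ^ n) :
      Nat.card (H.subgroupOf A) = p ^ (Nat.card A).factorization p := by
    rw [Nat.card_congr (Subgroup.subgroupOfEquivOfLe h).toEquiv, hH]
    congr 1
    refine le_antisymm ?_ hn
    rw [← (Fact.out : p.Prime).pow_dvd_iff_le_factorization Nat.card_pos.ne', ← hH]
    exact Subgroup.card_dvd_of_le h
  obtain ⟨g, hg⟩ := MulAction.exists_smul_eq A (Sylow.ofCard _ (hcard h₁ hH₁))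
    (Sylow.ofCard _ (hcard h₂ hH₂))
  refine ⟨g, g.2, fun x hx => ?_⟩
  have h4 := congrArg (fun P : Sylow p A => (P : Subgroup A)) hg
  simp only [Sylow.coe_subgroup_smul, Sylow.coe_ofCard] at h4
  have h5 : MulAut.conj g • (⟨x, h₁ hx⟩ : A) ∈ H₂.subgroupOf A := by
    rw [← h4]
    exact Subgroup.smul_mem_pointwise_smul _ _ _ (Subgroup.mem_subgroupOf.2 hx)
  simpa [Subgroup.mem_subgroupOf] using h5

end Group

/-! ### Subfunctions of maps that intertwine scalars. -/

section Subfunctions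

variable {p m : ℕ} [Fact p.Prime] {K : Type*} [Field K] [Finite K] [Algebra (ZMod p) K]

theorem apply_eq_sub (A : (K × K) ≃ₗ[ZMod p] (K × K)) (w : K × K) :
    A w = (sub₁ A w.1 + sub₂ A w.2, sub₃ A w.1 + sub₄ A w.2) := by
  have : A w = A (w.1, 0) + A (0, w.2) := by simp [← map_add]
  rw [this]
  rfl

/-- `A` intertwines `diag(a, a')` with `diag(b, b')`. -/
def Intertwines (A : (K × K) ≃ₗ[ZMod p] (K × K)) (a a' b b' : K) : Prop :=
  ∀ w, A (a * w.1, a' * w.2) = (b * (A w).1, b' * (A w).2)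

theorem Intertwines.sub {A : (K × K) ≃ₗ[ZMod p] (K × K)} {a a' b b' : K}
    (h : Intertwines A a a' b b') :
    (∀ x, sub₁ A (a * x) = b * sub₁ A x) ∧ (∀ x, sub₂ A (a' * x) = b * sub₂ A x) ∧
    (∀ x, sub₃ A (a * x) = b' * sub₃ A x) ∧ (∀ x, sub₄ A (a' * x) = b' * sub₄ A x) := by
  refine ⟨fun x => ?_, fun x => ?_, fun x => ?_, fun x => ?_⟩
  · simpa [sub₁] using congrArg Prod.fst (h (x, 0))
  · simpa [sub₂] using congrArg Prod.fst (h (0, x))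
  · simpa [sub₃] using congrArg Prod.snd (h (x, 0))
  · simpa [sub₄] using congrArg Prod.snd (h (0, x))

theorem Intertwines.isMonomial (hK : Nat.card K = p ^ m) {A : (K × K) ≃ₗ[ZMod p] (K × K)}
    {a a' b b' : K} (h : Intertwines A a a' b b') (ha : Algebra.adjoin (ZMod p) {a} = ⊤)
    (ha' : Algebra.adjoin (ZMod p) {a'} = ⊤) :
    (sub₁ A ≠ 0 → ∃ t < m, IsMonomial p t (sub₁ A)) ∧
    (sub₂ A ≠ 0 → ∃ t < m, IsMonomial p t (sub₂ A)) ∧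
    (sub₃ A ≠ 0 → ∃ t < m, IsMonomial p t (sub₃ A)) ∧
    (sub₄ A ≠ 0 → ∃ t < m, IsMonomial p t (sub₄ A)) := by
  obtain ⟨h1, h2, h3, h4⟩ := h.sub
  refine ⟨fun h0 => ?_, fun h0 => ?_, fun h0 => ?_, fun h0 => ?_⟩
  · exact exists_isMonomial_of_intertwines hK ha
      (A := LinearMap.fst _ _ _ ∘ₗ A.toLinearMap ∘ₗ LinearMap.inl _ _ _) h1
      (fun h => h0 (congrArg DFunLike.coe h))
  · exact exists_isMonomial_of_intertwines hK ha'
      (A := LinearMap.fst _ _ _ ∘ₗ A.toLinearMap ∘ₗ LinearMap.inr _ _ _) h2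
      (fun h => h0 (congrArg DFunLike.coe h))
  · exact exists_isMonomial_of_intertwines hK ha
      (A := LinearMap.snd _ _ _ ∘ₗ A.toLinearMap ∘ₗ LinearMap.inl _ _ _) h3
      (fun h => h0 (congrArg DFunLike.coe h))
  · exact exists_isMonomial_of_intertwines hK ha'
      (A := LinearMap.snd _ _ _ ∘ₗ A.toLinearMap ∘ₗ LinearMap.inr _ _ _) h4
      (fun h => h0 (congrArg DFunLike.coe h))

theorem sub₁_ne_zero_or_sub₃_ne_zero (A : (K × K) ≃ₗ[ZMod p] (K × K)) :
    sub₁ A ≠ 0 ∨ sub₃ A ≠ 0 := by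
  by_contra! h
  have h1 := apply_eq_sub A (1, 0)
  have h2 := apply_eq_sub A (0, 0)
  rw [h.1, h.2] at h1 h2
  simpa using A.injective (h1.trans h2.symm)

theorem sub₂_ne_zero_or_sub₄_ne_zero (A : (K × K) ≃ₗ[ZMod p] (K × K)) :
    sub₂ A ≠ 0 ∨ sub₄ A ≠ 0 := by
  by_contra! h
  have h1 := apply_eq_sub A (0, 1)
  have h2 := apply_eq_sub A (0, 0)
  rw [h.1, h.2] at h1 h2
  simpa using A.injective (h1.trans h2.symm)

/-- If `A` intertwines the scalars `a` and `b`, where `a` has order `p'`, then `b = a ^ (p ^ t)`. -/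
theorem Intertwines.exists_eq_pow {p' : ℕ} (hm : 0 < m) (hK : Nat.card K = p ^ m)
    (hp' : IsPrimitivePrimeDivisor p m p') {a : Kˣ} (ha : orderOf a = p') {b : K}
    {A : (K × K) ≃ₗ[ZMod p] (K × K)} (h : Intertwines A a a b b) :
    ∃ t < m, b = (a : K) ^ p ^ t := by
  have htop := adjoin_eq_top_of_orderOf hm hK hp' ha
  obtain ⟨h1, -, h3, -⟩ := h.isMonomial hK htop htop
  rcases sub₁_ne_zero_or_sub₃_ne_zero A with h0 | h0
  · obtain ⟨t, ht, h1⟩ := h1 h0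
    exact ⟨t, ht, h1.eq_of_intertwines h.sub.1⟩
  · obtain ⟨t, ht, h3⟩ := h3 h0
    exact ⟨t, ht, h3.eq_of_intertwines h.sub.2.2.1⟩

/-- Each monomial multiplies by its own Frobenius power of `a`; since `a` has order `p'`, that power
determines the degree modulo `m`. -/
theorem Intertwines.subfunctionsMonomialOfDegree {p' : ℕ} (hm : 0 < m) (hK : Nat.card K = p ^ m)
    (hp' : IsPrimitivePrimeDivisor p m p') {a : Kˣ} (ha : orderOf a = p') {t : ℕ}
    {A : (K × K) ≃ₗ[ZMod p] (K × K)} (h : Intertwines A a a ((a : K) ^ p ^ t) ((a : K) ^ p ^ t)) :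
    SubfunctionsMonomialOfDegree t A := by
  have htop := adjoin_eq_top_of_orderOf hm hK hp' ha
  have key {B : K → K} (hB : ∃ s < m, IsMonomial p s B)
      (hi : ∀ x, B (a * x) = (a : K) ^ p ^ t * B x) : IsMonomial p t B := by
    obtain ⟨s, -, hs⟩ := hB
    exact hs.congr_modEq hK (modEq_of_pow_pow_eq hm hp' ha (hs.eq_of_intertwines hi).symm)
  obtain ⟨h1, h2, h3, h4⟩ := h.isMonomial hK htop htop
  obtain ⟨i1, i2, i3, i4⟩ := h.sub
  exact ⟨fun h0 => key (h1 h0) i1, fun h0 => key (h2 h0) i2, fun h0 => key (h3 h0) i3,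
    fun h0 => key (h4 h0) i4⟩

theorem SubfunctionsMonomialOfDegree.eq_pow {t : ℕ} {A : (K × K) ≃ₗ[ZMod p] (K × K)}
    (hA : SubfunctionsMonomialOfDegree t A) {a b : K} (h : Intertwines A a a b b) :
    b = a ^ p ^ t := by
  rcases sub₁_ne_zero_or_sub₃_ne_zero A with h0 | h0
  · exact (hA.1 h0).eq_of_intertwines h.sub.1
  · exact (hA.2.2.1 h0).eq_of_intertwines h.sub.2.2.1

theorem SubfunctionsMonomialOfDegree.apply_mul {t : ℕ} {A : (K × K) ≃ₗ[ZMod p] (K × K)}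
    (hA : SubfunctionsMonomialOfDegree t A) (x : K) (w : K × K) :
    A (x * w.1, x * w.2) = (x ^ p ^ t * (A w).1, x ^ p ^ t * (A w).2) := by
  obtain ⟨h1, h2, h3, h4⟩ := hA
  have key {B : K → K} (hB : B ≠ 0 → IsMonomial p t B) (y : K) :
      B (x * y) = x ^ p ^ t * B y := by
    by_cases h0 : B = 0
    · simp [h0]
    · exact (hB h0).apply_mul x y
  rw [apply_eq_sub A, apply_eq_sub A w]
  simp only [key h1, key h2, key h3, key h4, mul_add]

variable {k l k' l' : ℕ}

theorem gammaHom_semiconj {g : GLTriple p (K × K)} {a b : Kˣ}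
    (h : g * gammaHom p k l K a = gammaHom p k' l' K b * g) :
    Intertwines g.1 ((a ^ (p ^ k + 1) : Kˣ) : K) ((a ^ (p ^ l + 1) : Kˣ) : K)
      ((b ^ (p ^ k' + 1) : Kˣ) : K) ((b ^ (p ^ l' + 1) : Kˣ) : K) ∧
    Intertwines g.2.1 (a : K) a b b ∧ Intertwines g.2.2 (a : K) a b b :=
  ⟨fun w => congrArg (fun f => f.1 w) h, fun w => congrArg (fun f => f.2.1 w) h,
    fun w => congrArg (fun f => f.2.2 w) h⟩

theorem gammaHom_injective : Function.Injective (gammaHom p k l K) := by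
  intro a b h
  have := congrArg (fun f => (f.2.1 (1, 0)).1) h
  refine Units.ext ?_
  simpa [gammaHom, diagMul_apply] using this

/-- A triple that conjugates `γ_a`, for all `a ∈ S`, to some `γ_b` induces a fixed power of the
Frobenius automorphism on `S`. -/
theorem exists_degree_of_semiconj {p' : ℕ} (hm : 0 < m) (hK : Nat.card K = p ^ m)
    (hp' : IsPrimitivePrimeDivisor p m p') {S : Subgroup Kˣ} {ω : Kˣ} (hωS : ω ∈ S)
    (hω : orderOf ω = p') {g : GLTriple p (K × K)}
    (hg : ∀ a ∈ S, ∃ b, g * gammaHom p k l K a = gammaHom p k' l' K b * g) :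
    ∃ t < m, SubfunctionsMonomialOfDegree t g.2.1 ∧ SubfunctionsMonomialOfDegree t g.2.2 ∧
      ∀ a ∈ S, g * gammaHom p k l K a = gammaHom p k' l' K (a ^ p ^ t) * g := by
  obtain ⟨b, hb⟩ := hg ω hωS
  obtain ⟨-, hL, hM⟩ := gammaHom_semiconj hb
  obtain ⟨t, ht, hbt⟩ := hL.exists_eq_pow hm hK hp' hω
  rw [hbt] at hL hM
  have hL' := hL.subfunctionsMonomialOfDegree hm hK hp' hω
  refine ⟨t, ht, hL', hM.subfunctionsMonomialOfDegree hm hK hp' hω, fun a ha => ?_⟩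
  obtain ⟨c, hc⟩ := hg a ha
  have : c = a ^ p ^ t := Units.ext (by simpa using hL'.eq_pow (gammaHom_semiconj hc).2.1)
  rw [← this, hc]

/-- The `N`-component sees `a ^ (q + 1)` and `a ^ (r + 1)`, which still have order `p'` and so
generate the field. -/
theorem subfunctions_isMonomial_of_semiconj {p' : ℕ} (hm : 0 < m) (hK : Nat.card K = p ^ m)
    (hp' : IsPrimitivePrimeDivisor p m p') (hk : ¬ m ∣ 2 * k) (hl : ¬ m ∣ 2 * l) {a b : Kˣ}
    (ha : orderOf a = p') {g : GLTriple p (K × K)}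
    (hg : g * gammaHom p k l K a = gammaHom p k' l' K b * g) :
    (sub₁ g.1 ≠ 0 → ∃ t < m, IsMonomial p t (sub₁ g.1)) ∧
    (sub₂ g.1 ≠ 0 → ∃ t < m, IsMonomial p t (sub₂ g.1)) ∧
    (sub₃ g.1 ≠ 0 → ∃ t < m, IsMonomial p t (sub₃ g.1)) ∧
    (sub₄ g.1 ≠ 0 → ∃ t < m, IsMonomial p t (sub₄ g.1)) := by
  have key {n : ℕ} (hn : ¬ m ∣ 2 * n) : orderOf (a ^ (p ^ n + 1)) = p' := by
    rw [Nat.Coprime.orderOf_pow, ha]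
    rw [ha]
    exact (hp'.coprime_pow_add_one (Fact.out : p.Prime).ne_zero hm hn).symm
  exact (gammaHom_semiconj hg).1.isMonomial hK (adjoin_eq_top_of_orderOf hm hK hp' (key hk))
    (adjoin_eq_top_of_orderOf hm hK hp' (key hl))

/-- A `p'`-element that induces a power of the Frobenius automorphism on `S` centralizes `γ(S)`. -/
theorem commute_of_semiconj {p' t : ℕ} (hm : 0 < m) (hK : Nat.card K = p ^ m)
    (hp' : IsPrimitivePrimeDivisor p m p') {S : Subgroup Kˣ} {g : GLTriple p (K × K)}
    (hg : ∀ a ∈ S, g * gammaHom p k l K a = gammaHom p k l K (a ^ p ^ t) * g)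
    {s : ℕ} (hs : g ^ p' ^ s = 1) {a : Kˣ} (ha : a ∈ S) : Commute g (gammaHom p k l K a) := by
  have key (n : ℕ) : ∀ a ∈ S, g ^ n * gammaHom p k l K a =
      gammaHom p k l K (a ^ p ^ (t * n)) * g ^ n := by
    induction n with
    | zero => simp
    | succ n ih =>
      intro a ha
      rw [pow_succ, mul_assoc, hg a ha, ← mul_assoc, ih _ (pow_mem ha _), mul_assoc, ← pow_mul,
        ← pow_add, Nat.mul_succ, add_comm]
  -- The `m`-th power of Frobenius is trivial, and `g` is a power of `g ^ m` because its order is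
  -- prime to `m`.
  have hgm : Commute (g ^ m) (gammaHom p k l K a) := by
    have h1 : a ^ p ^ (t * m) = a := Units.ext (by
      have := pow_pow_eq_of_modEq (i := t * m) (j := 0) hK
        (Nat.modEq_zero_iff_dvd.2 (dvd_mul_left _ _)) (a : K)
      simpa using this)
    have h2 := key m a ha
    rwa [h1] at h2
  have hco : (orderOf g).Coprime m :=
    Nat.Coprime.of_dvd_left (orderOf_dvd_of_pow_eq_one hs)
      ((hp'.coprime (Fact.out : p.Prime).ne_zero hm).pow_left s)
  obtain ⟨n, hn⟩ := exists_pow_eq_self_of_coprime hco.symm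
  exact hn ▸ hgm.pow_left n

end Subfunctions

/-! ### Semilinear forms and comparison of exponents. -/

section Forms

variable {p m : ℕ} [Fact p.Prime] {K : Type*} [Field K] [Finite K] [Algebra (ZMod p) K]

theorem congrPM_iff {a b : ℕ} : CongrPM m a b ↔ (a : ZMod m) = b ∨ (a : ZMod m) = -b := by
  simp [CongrPM, ← ZMod.intCast_eq_intCast_iff]

/-- `Φ` is `p ^ k`-semilinear in the first and linear in the second argument with respect to
scalars. -/
def FrobHomogeneous (p k : ℕ) (Φ : K × K → K × K → K) : Prop :=
  ∀ (x u : K) (z w : K × K), Φ (x * z.1, x * z.2) (u * w.1, u * w.2) = x ^ p ^ k * u * Φ z w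

theorem IsBiprojectivePreSemifield.exists_forms {k l : ℕ} {mul : K × K → K × K → K × K}
    (h : IsBiprojectivePreSemifield p k l mul) :
    ∃ Φ Ψ : K × K → K × K → K, FrobHomogeneous p k Φ ∧ FrobHomogeneous p l Ψ ∧
      (∀ z w, mul z w = (Φ z w + Φ w z, Ψ z w + Ψ w z)) ∧
      (∀ z w w', mul z (w + w') = mul z w + mul z w') ∧
      (∀ a, a ≠ 0 → ∀ z, mul a z = 0 → z = 0) := by
  obtain ⟨a₀, b₀, c₀, d₀, a₁, b₁, c₁, d₁, hpl, rfl⟩ := h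
  refine ⟨fun z w => a₀ * (z.1 ^ p ^ k * w.1) + b₀ * (z.1 ^ p ^ k * w.2)
      + c₀ * (z.2 ^ p ^ k * w.1) + d₀ * (z.2 ^ p ^ k * w.2),
    fun z w => a₁ * (z.1 ^ p ^ l * w.1) + b₁ * (z.1 ^ p ^ l * w.2)
      + c₁ * (z.2 ^ p ^ l * w.1) + d₁ * (z.2 ^ p ^ l * w.2), ?_, ?_, ?_, ?_, ?_⟩
  · intro x u z w
    simp only [mul_pow]
    ring
  · intro x u z w
    simp only [mul_pow]
    ring
  · intro z w
    refine Prod.ext ?_ ?_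
    all_goals
      simp only [polarization, biprojectiveMap, Prod.fst_sub, Prod.snd_sub, Prod.fst_add,
        Prod.snd_add, pow_succ, add_pow_pow p]
      ring
  · intro z w w'
    refine Prod.ext ?_ ?_
    all_goals
      simp only [polarization, biprojectiveMap, Prod.fst_sub, Prod.snd_sub, Prod.fst_add,
        Prod.snd_add, pow_succ, add_pow_pow p]
      ring
  · intro a ha z hz
    refine hpl a ha z ?_
    rw [← hz]
    simp only [polarization, add_comm z a]
    abel

theorem injective_of_presemifield {mul : K × K → K × K → K × K}
    (hadd : ∀ z w w', mul z (w + w') = mul z w + mul z w')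
    (hmul : ∀ a, a ≠ 0 → ∀ z, mul a z = 0 → z = 0) : Function.Injective (mul (1, 0)) := by
  refine (injective_iff_map_eq_zero (AddMonoidHom.mk' (mul (1, 0)) (hadd _))).2 fun z hz => ?_
  exact hmul _ (by simp) z hz

/-- Multiplication by `(1, 0)` is injective on a finite set, hence onto, so neither coordinate
vanishes identically. -/
theorem exists_form_ne_zero {mul : K × K → K × K → K × K} {Φ Ψ : K × K → K × K → K}
    (hform : ∀ z w, mul z w = (Φ z w + Φ w z, Ψ z w + Ψ w z))
    (hadd : ∀ z w w', mul z (w + w') = mul z w + mul z w')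
    (hmul : ∀ a, a ≠ 0 → ∀ z, mul a z = 0 → z = 0) :
    (∃ z w, Φ z w ≠ 0) ∧ ∃ z w, Ψ z w ≠ 0 := by
  have hsurj := Finite.surjective_of_injective (injective_of_presemifield hadd hmul)
  constructor
  · by_contra! h
    obtain ⟨w, hw⟩ := hsurj (1, 0)
    simp [hform, h] at hw
  · by_contra! h
    obtain ⟨w, hw⟩ := hsurj (0, 1)
    simp [hform, h] at hw

variable {k l k' t : ℕ}

/-- Comparison of exponents in an identity between two-variable Frobenius binomials. -/
theorem exponent_comparison {p' : ℕ} (hm : 0 < m) (hp' : IsPrimitivePrimeDivisor p m p') {a : Kˣ}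
    (ha : orderOf a = p') (hkl : ¬ CongrPM m k l) (hk : ¬ m ∣ 2 * k) {j s : ℕ}
    {α α' β β' ε ε' : K} (hα : α ≠ 0)
    (h : ∀ x u : K, α * (x ^ p ^ (k + j) * u ^ p ^ j) + α' * (x ^ p ^ j * u ^ p ^ (k + j)) +
      (β * (x ^ p ^ (l + s) * u ^ p ^ s) + β' * (x ^ p ^ s * u ^ p ^ (l + s))) =
      ε * (x ^ p ^ (t + k') * u ^ p ^ t) + ε' * (x ^ p ^ t * u ^ p ^ (t + k'))) :
    ((k : ZMod m) = k' ∧ j ≡ t [MOD m]) ∨ ((k : ZMod m) = -k' ∧ j ≡ t + k' [MOD m]) := by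
  rw [congrPM_iff] at hkl
  rw [← ZMod.natCast_eq_zero_iff] at hk
  push_cast at hk
  -- The `α` term is isolated. Matching `α'` would force `k ≡ 0`, and matching `β` or `β'` would
  -- force `k ≡ ± l`, so only the right-hand terms remain.
  obtain ⟨n, -, hn⟩ := exists_frobChar_eq (p := p) Finset.univ (k + j, j)
    ![(j, k + j), (l + s, s), (s, l + s), (t + k', t), (t, t + k')] (c₀ := α)
    ![-α', -β, -β', ε, ε'] hα (by
      intro x u
      simp only [Fin.sum_univ_succ, Finset.univ_eq_empty, Finset.sum_empty, Matrix.cons_val_zero,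
        Matrix.cons_val_succ]
      linear_combination h x u)
  obtain ⟨h1, h2⟩ := frobChar_eq hm hp' ha hn
  simp only [← ZMod.natCast_eq_natCast_iff] at h1 h2 ⊢
  fin_cases n <;> simp at h1 h2
  · exact absurd (by linear_combination 2 * h1) hk
  · exact absurd (Or.inl (by linear_combination h1 - h2)) hkl
  · exact absurd (Or.inr (by linear_combination h1 - h2)) hkl
  · exact Or.inl ⟨by linear_combination h1 - h2, h2⟩
  · refine Or.inr ⟨by linear_combination h1 - h2, by push_cast; exact h2⟩

/-- The degree of a monomial that transforms one component of an isotopism. -/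
theorem degree_of_component {p' : ℕ} (hm : 0 < m) (hK : Nat.card K = p ^ m)
    (hp' : IsPrimitivePrimeDivisor p m p') {a : Kˣ} (ha : orderOf a = p')
    (hkl : ¬ CongrPM m k l) (hk : ¬ m ∣ 2 * k) {Φ Ψ Θ : K × K → K × K → K}
    (hΦ : FrobHomogeneous p k Φ) (hΦ0 : ∃ z w, Φ z w ≠ 0) (hΨ : FrobHomogeneous p l Ψ)
    (hΘ : FrobHomogeneous p k' Θ) {L M : (K × K) ≃ₗ[ZMod p] (K × K)}
    (hL : SubfunctionsMonomialOfDegree t L) (hM : SubfunctionsMonomialOfDegree t M) {A B : K → K}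
    (hA : A ≠ 0 → ∃ s < m, IsMonomial p s A) (hB : B ≠ 0 → ∃ s < m, IsMonomial p s B)
    (h : ∀ z w, A (Φ z w + Φ w z) + B (Ψ z w + Ψ w z) = Θ (L z) (M w) + Θ (M w) (L z))
    (hA0 : A ≠ 0) :
    CongrPM m k k' ∧ ((k : ℤ) ≡ k' [ZMOD m] → IsMonomial p t A) ∧
      ((k : ℤ) ≡ -k' [ZMOD m] → IsMonomial p (t + k') A) := by
  obtain ⟨j, -, hj⟩ := hA hA0
  obtain ⟨c, hc, hAc⟩ := hj
  -- The coefficient `d = 0` is allowed, which covers `B = 0` without a separate comparison.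
  obtain ⟨d, s, hBd⟩ : ∃ d s, ∀ x, B x = d * x ^ p ^ s := by
    by_cases hB0 : B = 0
    · exact ⟨0, 0, by simp [hB0]⟩
    · obtain ⟨s, -, d, -, hd⟩ := hB hB0
      exact ⟨d, s, hd⟩
  obtain ⟨z, w, hzw⟩ := hΦ0
  have key := exponent_comparison (k := k) (l := l) (k' := k') (t := t) (j := j) (s := s) hm hp' ha
    hkl hk (α := c * Φ z w ^ p ^ j) (α' := c * Φ w z ^ p ^ j) (β := d * Ψ z w ^ p ^ s)
    (β' := d * Ψ w z ^ p ^ s) (ε := Θ (L z) (M w)) (ε' := Θ (M w) (L z))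
    (mul_ne_zero hc (pow_ne_zero _ hzw)) (by
      intro x u
      have h1 := h (x * z.1, x * z.2) (u * w.1, u * w.2)
      rw [hL.apply_mul, hM.apply_mul, hΦ, hΦ, hΨ, hΨ, hΘ, hΘ, hAc, hBd, add_pow_pow p,
        add_pow_pow p] at h1
      simp only [mul_pow, ← pow_mul, ← pow_add] at h1
      linear_combination h1)
  have hmono : IsMonomial p j A := ⟨c, hc, hAc⟩
  rw [congrPM_iff]
  have e1 : (k : ℤ) ≡ k' [ZMOD m] ↔ (k : ZMod m) = k' := by
    simp [← ZMod.intCast_eq_intCast_iff]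
  have e2 : (k : ℤ) ≡ -k' [ZMOD m] ↔ (k : ZMod m) = -k' := by
    simp [← ZMod.intCast_eq_intCast_iff]
  rw [e1, e2]
  rw [← ZMod.natCast_eq_zero_iff] at hk
  push_cast at hk
  -- The two signs exclude each other because `2 * k` is non-zero modulo `m`, so the degree is
  -- unambiguous.
  rcases key with ⟨h1, h2⟩ | ⟨h1, h2⟩
  · exact ⟨Or.inl h1, fun _ => hmono.congr_modEq hK h2,
      fun h3 => absurd (by linear_combination h1 + h3) hk⟩
  · exact ⟨Or.inr h1, fun h3 => absurd (by linear_combination h1 + h3) hk,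
      fun _ => hmono.congr_modEq hK h2⟩

end Forms

/-! ### Isotopisms that respect `Z_R`. -/

section Isotopisms

variable {p m : ℕ} [Fact p.Prime] {K : Type*} [Field K] [Finite K] [Algebra (ZMod p) K]

/-- In `2 * k = m * c`, an even `c` gives `k ≡ 0` and an odd `c` gives `k ≡ m / 2`; the latter is
phrased modulo `2 * m` to avoid halving `m`. -/
theorem not_dvd_two_mul {m k : ℕ} (hk : ¬ k ≡ 0 [MOD m]) (hkQ : ¬ 2 * k ≡ m [MOD 2 * m]) :
    ¬ m ∣ 2 * k := by
  rintro ⟨c, hc⟩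
  obtain ⟨d, rfl | rfl⟩ := Nat.even_or_odd' c
  · exact hk ((Nat.modEq_zero_iff_dvd).2 ⟨d, by linarith⟩)
  · refine hkQ ?_
    rw [hc, show m * (2 * d + 1) = m + 2 * m * d by ring]
    simp [Nat.ModEq]

theorem CongrPM.symm {a b : ℕ} (h : CongrPM m a b) : CongrPM m b a := by
  rw [congrPM_iff] at h ⊢
  rcases h with h | h
  · exact Or.inl h.symm
  · exact Or.inr (by rw [h, neg_neg])

theorem CongrPM.trans {a b c : ℕ} (h : CongrPM m a b) (h' : CongrPM m b c) : CongrPM m a c := by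
  rw [congrPM_iff] at h h' ⊢
  rcases h with h | h <;> rcases h' with h' | h' <;> simp [h, h']

theorem groupZ_le_autotopismGroup {k l : ℕ} {mul : K × K → K × K → K × K}
    (h : IsBiprojectivePreSemifield p k l mul) : groupZ p k l K ≤ autotopismGroup p mul := by
  rintro _ ⟨a, rfl⟩
  obtain ⟨Φ, Ψ, hΦ, hΨ, hform, -⟩ := h.exists_forms
  intro z w
  have h1 (w : K × K) : (gammaHom p k l K a).2.1 w = (a * w.1, a * w.2) := rfl
  have h2 (w : K × K) : (gammaHom p k l K a).2.2 w = (a * w.1, a * w.2) := rfl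
  have h3 (w : K × K) : (gammaHom p k l K a).1 w =
      (((a ^ (p ^ k + 1) : Kˣ) : K) * w.1, ((a ^ (p ^ l + 1) : Kˣ) : K) * w.2) := rfl
  rw [h1, h2, h3, hform, hform, hΦ, hΦ, hΨ, hΨ, Units.val_pow_eq_pow_val, Units.val_pow_eq_pow_val]
  refine Prod.ext ?_ ?_ <;> · simp only; ring

theorem IsIsotopism.mul {V : Type*} [AddCommGroup V] [Module (ZMod p) V]
    {mul₁ mul₂ mul₃ : V → V → V} {g h : GLTriple p V} (hg : IsIsotopism mul₂ mul₃ g) (hh : IsIsotopism mul₁ mul₂ h) :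
    IsIsotopism mul₁ mul₃ (g * h) := fun x y => by
  change g.1 (h.1 (mul₁ x y)) = _
  rw [hh, hg]
  rfl

theorem IsIsotopism.inv {V : Type*} [AddCommGroup V] [Module (ZMod p) V] {mul₁ mul₂ : V → V → V}
    {g : GLTriple p V} (hg : IsIsotopism mul₁ mul₂ g) : IsIsotopism mul₂ mul₁ g⁻¹ := fun x y => by
  change g.1.symm (mul₂ x y) = mul₁ (g.2.1.symm x) (g.2.2.symm y)
  rw [LinearEquiv.symm_apply_eq, hg, LinearEquiv.apply_symm_apply, LinearEquiv.apply_symm_apply]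

instance finite_GLTriple {V : Type*} [AddCommGroup V] [Module (ZMod p) V] [Finite V] :
    Finite (GLTriple p V) := by
  have : Finite (V ≃ₗ[ZMod p] V) := Finite.of_injective _ DFunLike.coe_injective
  infer_instance

theorem card_groupZR (k l : ℕ) (R : Subgroup Kˣ) :
    Nat.card (groupZR p k l R) = Nat.card R :=
  Subgroup.card_map_of_injective gammaHom_injective

theorem exists_orderOf_eq_of_sylow {p' : ℕ} (hK : Nat.card K = p ^ m)
    (hp' : IsPrimitivePrimeDivisor p m p') (R : Sylow p' Kˣ) :
    ∃ ω ∈ (R : Subgroup Kˣ), orderOf ω = p' := by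
  have : Fact p'.Prime := ⟨hp'.1⟩
  have h1 : p' ∣ Nat.card Kˣ := by
    rw [Nat.card_units, hK]
    exact hp'.2.1
  obtain ⟨ω, hω⟩ := exists_prime_orderOf_dvd_card' (G := R) p' (R.dvd_card_of_dvd_card h1)
  exact ⟨ω, ω.2, by rw [Subgroup.orderOf_coe, hω]⟩

/-- Under Condition (C), `Z_R` is a Sylow `p'`-subgroup of the autotopism group. -/
theorem not_dvd_card_autotopismGroup {p' k l : ℕ} (hm : 0 < m) (hK : Nat.card K = p ^ m)
    (hp' : IsPrimitivePrimeDivisor p m p') (R : Sylow p' Kˣ) {mul : K × K → K × K → K × K}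
    (h : IsBiprojectivePreSemifield p k l mul)
    (hZC : groupZ p k l K ≤ centralizerZR p k l (R : Subgroup Kˣ) mul)
    (hI : ¬ p' ∣ (groupZ p k l K).relIndex (centralizerZR p k l (R : Subgroup Kˣ) mul)) :
    ¬ p' ^ ((Nat.card Kˣ).factorization p' + 1) ∣ Nat.card (autotopismGroup p mul) := by
  have : Fact p'.Prime := ⟨hp'.1⟩
  have hZR : groupZR p k l (R : Subgroup Kˣ) ≤ autotopismGroup p mul :=
    (Subgroup.map_le_range _ _).trans (groupZ_le_autotopismGroup h)
  refine not_dvd_card_of_normalizing hZR ((card_groupZR k l _).trans R.card_eq_multiplicity)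
    (C := centralizerZR p k l (R : Subgroup Kˣ) mul) ?_ ?_
  · intro hd
    have hZ : Nat.card (groupZ p k l K) = Nat.card Kˣ :=
      (Nat.card_congr (MonoidHom.ofInjective gammaHom_injective).toEquiv).symm
    -- The centralizer has order `|Kˣ|` times the index, and the index is prime to `p'`.
    rw [← Subgroup.relIndex_bot_left, ← Subgroup.relIndex_mul_relIndex _ _ _ bot_le hZC,
      Subgroup.relIndex_bot_left, hZ] at hd
    exact Nat.pow_succ_factorization_not_dvd Nat.card_pos.ne' hp'.1
      ((((Nat.Prime.coprime_iff_not_dvd hp'.1).2 hI).pow_left _).dvd_of_dvd_mul_right hd)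
  · rintro g hg hnorm ⟨s, hs⟩
    obtain ⟨ω, hωR, hω⟩ := exists_orderOf_eq_of_sylow hK hp' R
    obtain ⟨t, -, -, -, ht⟩ := exists_degree_of_semiconj (g := g) hm hK hp' hωR hω
      (k := k) (l := l) (k' := k) (l' := l) (fun a ha => by
        obtain ⟨b, -, hb⟩ := hnorm _ (Subgroup.mem_map_of_mem _ ha)
        exact ⟨b, by rw [hb, inv_mul_cancel_right]⟩)
    refine ⟨hg, Subgroup.mem_centralizer_iff.2 ?_⟩
    rintro _ ⟨a, ha, rfl⟩
    exact (commute_of_semiconj hm hK hp' ht hs ha).symm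

/-- Under Condition (C), isotopic pre-semifields admit an isotopism that conjugates `Z_R` into
`Z_R`. -/
theorem exists_isotopism_semiconj {p' k₁ l₁ k₂ l₂ : ℕ} (hm : 0 < m) (hK : Nat.card K = p ^ m)
    (hp' : IsPrimitivePrimeDivisor p m p') (R : Sylow p' Kˣ) {mul₁ mul₂ : K × K → K × K → K × K}
    (h₁ : IsBiprojectivePreSemifield p k₁ l₁ mul₁) (h₂ : IsBiprojectivePreSemifield p k₂ l₂ mul₂)
    (hZC : groupZ p k₁ l₁ K ≤ centralizerZR p k₁ l₁ (R : Subgroup Kˣ) mul₁)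
    (hI : ¬ p' ∣ (groupZ p k₁ l₁ K).relIndex (centralizerZR p k₁ l₁ (R : Subgroup Kˣ) mul₁))
    (hiso : IsIsotopic p mul₁ mul₂) :
    ∃ g : GLTriple p (K × K), IsIsotopism mul₁ mul₂ g ∧ ∀ a ∈ (R : Subgroup Kˣ), ∃ b,
      g * gammaHom p k₁ l₁ K a = gammaHom p k₂ l₂ K b * g := by
  have : Fact p'.Prime := ⟨hp'.1⟩
  obtain ⟨δ, hδ⟩ := hiso
  have hle₁ : groupZR p k₁ l₁ (R : Subgroup Kˣ) ≤ autotopismGroup p mul₁ :=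
    (Subgroup.map_le_range _ _).trans (groupZ_le_autotopismGroup h₁)
  -- Pulling back along `δ` puts both groups in the first autotopism group, so Condition (C) is
  -- needed only there.
  have hle₂ : (groupZR p k₂ l₂ (R : Subgroup Kˣ)).map (MulAut.conj δ⁻¹).toMonoidHom ≤
      autotopismGroup p mul₁ := by
    rintro _ ⟨x, hx, rfl⟩
    have hx' : IsIsotopism mul₂ mul₂ x :=
      groupZ_le_autotopismGroup h₂ (Subgroup.map_le_range _ _ hx)
    have := (hδ.inv.mul hx').mul hδ
    change IsIsotopism mul₁ mul₁ _
    simpa using this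
  obtain ⟨g, hg, hconj⟩ := exists_conj_of_card_eq hle₁ hle₂
    ((card_groupZR k₁ l₁ _).trans R.card_eq_multiplicity)
    ((Subgroup.card_map_of_injective (MulAut.conj δ⁻¹).injective).trans
      ((card_groupZR k₂ l₂ _).trans R.card_eq_multiplicity))
    (not_dvd_card_autotopismGroup hm hK hp' R h₁ hZC hI)
  refine ⟨δ * g, hδ.mul hg, fun a ha => ?_⟩
  obtain ⟨_, ⟨b, -, rfl⟩, hb⟩ := hconj _ (Subgroup.mem_map_of_mem _ ha)
  refine ⟨b, ?_⟩
  have hb' : δ⁻¹ * gammaHom p k₂ l₂ K b * δ = g * gammaHom p k₁ l₁ K a * g⁻¹ := by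
    simpa using hb
  rw [eq_mul_inv_iff_mul_eq] at hb'
  rw [mul_assoc, ← hb']
  group

end Isotopisms

/-! ### The shape of the isotopism. -/

theorem theorem5p8 {p m : ℕ} [Fact p.Prime] (hp : p ≠ 2)
    {K : Type*} [Field K] [Finite K] [Algebra (ZMod p) K] (hK : Nat.card K = p ^ m)
    {p' : ℕ} (hp' : IsPrimitivePrimeDivisor p m p') (R : Sylow p' Kˣ)
    {k₁ l₁ k₂ l₂ : ℕ}
    -- `q₁ ∉ {r₁, r̄₁}`, `1 ∉ {q₁, r₁}` and `Q = p ^ (m / 2) ∉ {q₁, r₁}`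
    (hkl : ¬ CongrPM m k₁ l₁)
    (hk : ¬ (k₁ ≡ 0 [MOD m])) (hl : ¬ (l₁ ≡ 0 [MOD m]))
    (hkQ : ¬ (2 * k₁ ≡ m [MOD 2 * m])) (hlQ : ¬ (2 * l₁ ≡ m [MOD 2 * m]))
    {mul₁ mul₂ : K × K → K × K → K × K}
    (h₁ : IsBiprojectivePreSemifield p k₁ l₁ mul₁)
    (h₂ : IsBiprojectivePreSemifield p k₂ l₂ mul₂)
    -- Condition (C)
    (hZC : groupZ p k₁ l₁ K ≤ centralizerZR p k₁ l₁ (R : Subgroup Kˣ) mul₁)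
    (hI : ¬ p' ∣ (groupZ p k₁ l₁ K).relIndex (centralizerZR p k₁ l₁ (R : Subgroup Kˣ) mul₁))
    (hiso : IsIsotopic p mul₁ mul₂) :
    ∃ (N L M : (K × K) ≃ₗ[ZMod p] (K × K)) (t : ℕ),
      IsIsotopism mul₁ mul₂ (N, L, M) ∧ t < m ∧
      SubfunctionsMonomial N ∧
      SubfunctionsMonomialOfDegree t L ∧ SubfunctionsMonomialOfDegree t M ∧
      ((CongrPM m k₁ k₂ ∧ CongrPM m l₁ l₂) ∨ (CongrPM m k₁ l₂ ∧ CongrPM m l₁ k₂)) ∧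
      ((sub₂ N = 0 ∧ sub₃ N = 0 ∧ sub₁ N ≠ 0 ∧ sub₄ N ≠ 0 ∧
          CongrPM m k₁ k₂ ∧ CongrPM m l₁ l₂ ∧
          ((k₁ : ℤ) ≡ k₂ [ZMOD m] → IsMonomial p t (sub₁ N)) ∧
          ((l₁ : ℤ) ≡ l₂ [ZMOD m] → IsMonomial p t (sub₄ N)) ∧
          ((k₁ : ℤ) ≡ -k₂ [ZMOD m] → IsMonomial p (t + k₂) (sub₁ N)) ∧
          ((l₁ : ℤ) ≡ -l₂ [ZMOD m] → IsMonomial p (t + l₂) (sub₄ N))) ∨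
       (sub₁ N = 0 ∧ sub₄ N = 0 ∧ sub₂ N ≠ 0 ∧ sub₃ N ≠ 0 ∧
          CongrPM m k₁ l₂ ∧ CongrPM m l₁ k₂ ∧
          ((k₁ : ℤ) ≡ l₂ [ZMOD m] → IsMonomial p t (sub₃ N)) ∧
          ((l₁ : ℤ) ≡ k₂ [ZMOD m] → IsMonomial p t (sub₂ N)) ∧
          ((k₁ : ℤ) ≡ -l₂ [ZMOD m] → IsMonomial p (t + l₂) (sub₃ N)) ∧
          ((l₁ : ℤ) ≡ -k₂ [ZMOD m] → IsMonomial p (t + k₂) (sub₂ N)))) := by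
  have hm : 0 < m := by
    refine Nat.pos_of_ne_zero fun h0 => ?_
    rw [h0, pow_zero] at hK
    have := Finite.one_lt_card (α := K)
    omega
  have hk2 := not_dvd_two_mul hk hkQ
  have hl2 := not_dvd_two_mul hl hlQ
  have hlk : ¬ CongrPM m l₁ k₁ := fun h => hkl h.symm
  obtain ⟨g, hg, hconj⟩ := exists_isotopism_semiconj hm hK hp' R h₁ h₂ hZC hI hiso
  obtain ⟨ω, hωR, hω⟩ := exists_orderOf_eq_of_sylow hK hp' R
  obtain ⟨t, ht, hL, hM, -⟩ := exists_degree_of_semiconj hm hK hp' hωR hω hconj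
  obtain ⟨b, hb⟩ := hconj ω hωR
  obtain ⟨n1, n2, n3, n4⟩ := subfunctions_isMonomial_of_semiconj hm hK hp' hk2 hl2 hω hb
  obtain ⟨Φ₁, Ψ₁, hΦ₁, hΨ₁, hform₁, hadd₁, hpl₁⟩ := h₁.exists_forms
  obtain ⟨Φ₂, Ψ₂, hΦ₂, hΨ₂, hform₂, -, -⟩ := h₂.exists_forms
  obtain ⟨hΦ0, hΨ0⟩ := exists_form_ne_zero hform₁ hadd₁ hpl₁
  obtain ⟨N, L, M⟩ := g
  have hrow (z w : K × K) := hg z w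
  simp only [hform₁, hform₂, apply_eq_sub N, Prod.mk.injEq] at hrow
  -- One comparison per subfunction of `N`: the column selects `k₁` or `l₁`, the row `k₂` or `l₂`.
  have d1 := degree_of_component hm hK hp' hω hkl hk2 hΦ₁ hΦ0 hΨ₁ hΦ₂ hL hM n1 n2
    fun z w => (hrow z w).1
  have d2 := degree_of_component hm hK hp' hω hlk hl2 hΨ₁ hΨ0 hΦ₁ hΦ₂ hL hM n2 n1
    fun z w => (add_comm _ _).trans (hrow z w).1
  have d3 := degree_of_component hm hK hp' hω hkl hk2 hΦ₁ hΦ0 hΨ₁ hΨ₂ hL hM n3 n4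
    fun z w => (hrow z w).2
  have d4 := degree_of_component hm hK hp' hω hlk hl2 hΨ₁ hΨ0 hΦ₁ hΨ₂ hL hM n4 n3
    fun z w => (add_comm _ _).trans (hrow z w).2
  have hN : SubfunctionsMonomial N :=
    ⟨fun h => (n1 h).imp fun _ h => h.2, fun h => (n2 h).imp fun _ h => h.2,
      fun h => (n3 h).imp fun _ h => h.2, fun h => (n4 h).imp fun _ h => h.2⟩
  -- Two non-zero entries in the first row would give `k₁ ≡ ± k₂ ≡ ± l₁`.
  have h12 : sub₁ N ≠ 0 → sub₂ N = 0 := fun h => by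
    by_contra h'
    exact hkl ((d1 h).1.trans (d2 h').1.symm)
  have h34 : sub₃ N ≠ 0 → sub₄ N = 0 := fun h => by
    by_contra h'
    exact hkl ((d3 h).1.trans (d4 h').1.symm)
  refine ⟨N, L, M, t, hg, ht, hN, hL, hM, ?_⟩
  -- With at most one non-zero entry per row and none of the columns zero, `N` is diagonal or
  -- antidiagonal.
  by_cases h1 : sub₁ N = 0
  · have h3 := (sub₁_ne_zero_or_sub₃_ne_zero N).resolve_left (not_not.2 h1)
    have h4 := h34 h3
    have h2 := (sub₂_ne_zero_or_sub₄_ne_zero N).resolve_right (not_not.2 h4)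
    exact ⟨Or.inr ⟨(d3 h3).1, (d2 h2).1⟩, Or.inr ⟨h1, h4, h2, h3, (d3 h3).1, (d2 h2).1,
      (d3 h3).2.1, (d2 h2).2.1, (d3 h3).2.2, (d2 h2).2.2⟩⟩
  · have h2 := h12 h1
    have h4 := (sub₂_ne_zero_or_sub₄_ne_zero N).resolve_left (not_not.2 h2)
    have h3 : sub₃ N = 0 := by
      by_contra h3
      exact h4 (h34 h3)
    exact ⟨Or.inl ⟨(d1 h1).1, (d4 h4).1⟩, Or.inl ⟨h2, h3, h1, h4, (d1 h1).1, (d4 h4).1,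
      (d1 h1).2.1, (d4 h4).2.1, (d1 h1).2.2, (d4 h4).2.2⟩⟩
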